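/- Let $r \ge 0$ and $k \ge 1$ be integers. \emph{The Hanoi graph $G_{r,k}$.} Its vertices are the sequences $(x_1,\dots,x_k)\in\{0,1,\dots,r\}^k$ with $x_i\ne x_{i-1}$ for all $1<i\le k$. Each such sequence is joined to every other such sequence that can be obtained from it by one of two moves: an \emph{adjustment}, which changes $x_k$ to a different value (other than $x_{k-1}$ if $k\ge 2$), or, for $k\ge2$, the \emph{involution}, which swaps the values $x_k$ and $x_{k-1}$ in the longest tail segment of the sequence on which these two values alternate. \emph{Truncation.} For a set $S$ of points of the unit sphere of a real inner product space $E$, the 1-skeleton of the convex hull $\operatorname{conv} S$ is the graph whose vertices are the extreme points of $\operatorname{conv} S$, two distinct vertices being adjacent if the segment between them (an edge) is a face of $\operatorname{conv} S$. Call $\delta\in(0,1)$ admissible for $S$ if the sphere of radius $1-\delta$ about the origin meets each edge in exactly two points. The truncation of $S$ at an admissible depth $\delta$ is the set of all these intersection points, scaled by the factor $1/(1-\delta)$ so that they lie on the unit sphere again. \textbf{Proposition.} Let $E$ be a real inner product space (for instance $E=\mathbb{R}^r$), and start with $r+1$ points in general position, that is, affinely independent, on the unit sphere of $E$. Apply $k-1$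 successive truncations, each at an arbitrary admissible depth, and let $S$ be the resulting set of points. Then the 1-skeleton of $\operatorname{conv} S$ is isomorphic to the Hanoi graph $G_{r,k}$. Moreover, all sufficiently small $\delta>0$ are admissible for $S$, so that the truncations can always be carried out and continued. -/

import Mathlib

/-- A finite sequence `x = (x_1, …, x_k)` with values in `{0, …, r}` is a Hanoi state if any two
consecutive entries differ (`x_i` is `x ⟨i - 1, _⟩` in Lean's indexing from `0`). -/
def IsHanoiState {r k : ℕ} (x : Fin k → Fin (r + 1)) : Prop :=
  ∀ i j : Fin k, i.val + 1 = j.val → x i ≠ x j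

/-- The set of Hanoi states of length `k` with values in `{0, …, r}`. -/
abbrev HanoiState (r k : ℕ) : Type := {x : Fin k → Fin (r + 1) // IsHanoiState x}

/-- `y` is obtained from `x` by an adjustment: only the last entry is changed. As `y` is again a
Hanoi state, the new last entry differs from the last but one. -/
def IsAdjustment {r k : ℕ} (x y : HanoiState r k) : Prop :=
  ∀ i : Fin k, i.val + 1 < k → y.1 i = x.1 i

/-- `y` is obtained from `x` by the involution: with `a` the last and `b` the last but one entry
of `x`, the values `a` and `b` are exchanged on the longest tail segment of `x` that contains no
other values (as consecutive entries of `x` differ, this is the longest tail segment on which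
`a` and `b` alternate), and all entries before that segment are kept. -/
def IsInvolution {r k : ℕ} (x y : HanoiState r k) : Prop :=
  ∃ a b : Fin k, a.val + 1 = k ∧ b.val + 2 = k ∧
    ∀ i : Fin k, y.1 i =
      if ∀ j : Fin k, i ≤ j → (x.1 j = x.1 a ∨ x.1 j = x.1 b)
      then Equiv.swap (x.1 a) (x.1 b) (x.1 i)
      else x.1 i

/-- The Hanoi graph: the vertices are the Hanoi states, and each state is joined to all the other
states that can be obtained from it by a single move. -/
def hanoiGraph (r k : ℕ) : SimpleGraph (HanoiState r k) :=
  SimpleGraph.fromRel fun x y => IsAdjustment x y ∨ IsInvolution x y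

section Truncation

variable {E : Type*} [NormedAddCommGroup E] [InnerProductSpace ℝ E]

/-- The 1-skeleton of the convex hull of `S`: the vertices are the extreme points of the convex
hull, and two distinct vertices are adjacent if the segment between them is a face of the convex
hull. -/
def hullSkeleton (S : Set E) : SimpleGraph ((convexHull ℝ S).extremePoints ℝ) where
  Adj x y := x ≠ y ∧ IsExtreme ℝ (convexHull ℝ S) (segment ℝ (x : E) (y : E))
  symm := ⟨fun x y h => ⟨h.1.symm, by rw [segment_symm]; exact h.2⟩⟩
  loopless := ⟨fun _ h => h.1 rfl⟩

/-- `δ` is small enough to truncate the set `S` of points of the unit sphere: the concentric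
sphere of (positive) radius `1 - δ < 1` meets each edge of the 1-skeleton of the convex hull of `S`
in exactly two points. -/
def IsTruncationDepth (S : Set E) (δ : ℝ) : Prop :=
  0 < δ ∧ δ < 1 ∧ ∀ x y, (hullSkeleton S).Adj x y →
    (segment ℝ (x : E) (y : E) ∩ Metric.sphere (0 : E) (1 - δ)).ncard = 2

/-- The truncation of `S` at depth `δ`: all points where the sphere of radius `1 - δ` meets an edge
of the 1-skeleton of the convex hull of `S`, scaled back to the unit sphere. -/
def truncation (S : Set E) (δ : ℝ) : Set E :=
  {z | ∃ x y, (hullSkeleton S).Adj x y ∧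
    ∃ w ∈ segment ℝ (x : E) (y : E) ∩ Metric.sphere (0 : E) (1 - δ), z = (1 - δ)⁻¹ • w}

/-- The set obtained from `S` by `n` successive truncations, at depths `δ 0, …, δ (n - 1)`. -/
def iteratedTruncation (S : Set E) (δ : ℕ → ℝ) : ℕ → Set E
  | 0 => S
  | n + 1 => truncation (iteratedTruncation S δ n) (δ n)

end Truncation

/-!
The proof rests on two facts: the truncation of a simple polytope inscribed in the unit sphere is
again such a polytope, with the truncated graph as its graph, and the truncation of the Hanoi graph
`G_{r,k}` is `G_{r,k+1}`.

For the first, `IsSimplePolytope G p` says of points `p x` of the unit sphere and a graph `G` on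
their labels that at each point the directions to its neighbours in `G` are linearly independent and
generate a cone that contains all the other points. For this condition no dimension or face lattice
is needed, and it forces `G` to be the 1-skeleton of the convex hull: an edge of `G` spans an
extreme ray of a simplicial cone around the hull, which the ball cuts down to the segment,
and conversely an extreme ray of the cone must be one of its generators
(`IsSimplePolytope.isExtreme_segment_iff`).
The condition is inherited by the truncation (`IsSimplePolytope.truncation`). The essential point is
that the hyperplane through the cut points next to a vertex `x` separates `x` from all other cut
points. As every edge is cut in its first half, the functional defining the hyperplane is larger
than `2` at the neighbours of `x`, if it is normalised to be `0` at `x` and `1` on the hyperplane,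
and a local minimum of a linear functional on a polytope is a global one
(`IsSimplePolytope.le_apply_sub`), so that it is at least `2` at all vertices other than `x`.

For the second, the vertices of the truncated graph are the oriented edges of the old graph. A state
`z` of length `k + 1` is read as the oriented edge from the first `k` entries of `z` to the first
`k` entries of its involution; the last entry of `z` thus names the neighbour by its last entry. The
involution then reverses edges, and adjustments keep the initial vertex (`HanoiState.dartIso`).

The induction starts with the simplex, whose graph is complete. Small depths are admissible since
the midpoints of the finitely many edges lie in the open unit ball.
-/

/-! ### Conical combinations -/

section Cone

variable {E : Type*} [AddCommGroup E] [Module ℝ E]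

/-- Induction on a conical combination, with scalars taken in `ℝ`. -/
theorem PointedCone.hull_induction_real {s : Set E} {P : E → Prop} (mem : ∀ v ∈ s, P v)
    (zero : P 0) (add : ∀ v w, v ∈ PointedCone.hull ℝ s → w ∈ PointedCone.hull ℝ s →
      P v → P w → P (v + w))
    (smul : ∀ a : ℝ, 0 < a → ∀ v, P v → P (a • v)) {v : E} (hv : v ∈ PointedCone.hull ℝ s) :
    P v := by
  induction hv using Submodule.span_induction with
  | mem v hv => exact mem v hv
  | zero => exact zero
  | add v w hv hw h h' => exact add v w hv hw h h'
  | smul a v _ h =>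
    rcases a.2.eq_or_lt with h0 | h0
    · rw [show a = 0 from Subtype.ext h0.symm, zero_smul]
      exact zero
    · exact smul a h0 v h

theorem PointedCone.smul_mem_hull {s : Set E} {v : E} {a : ℝ} (ha : 0 ≤ a)
    (hv : v ∈ PointedCone.hull ℝ s) : a • v ∈ PointedCone.hull ℝ s :=
  Submodule.smul_mem _ (⟨a, ha⟩ : {c : ℝ // 0 ≤ c}) hv

theorem PointedCone.map_nonneg_of_mem_hull {s : Set E} (l : E →ₗ[ℝ] ℝ) (hl : ∀ v ∈ s, 0 ≤ l v)
    {v : E} (hv : v ∈ PointedCone.hull ℝ s) : 0 ≤ l v := by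
  refine PointedCone.hull_induction_real hl (by simp) (fun v w _ _ h h' => ?_)
    (fun a ha v h => ?_) hv
  · rw [map_add]; exact add_nonneg h h'
  · rw [map_smul, smul_eq_mul]; positivity

/-- A nonzero element of a cone has a generator as a summand. -/
theorem PointedCone.exists_eq_smul_add_of_mem_hull {s : Set E} {v : E}
    (hv : v ∈ PointedCone.hull ℝ s) :
    v = 0 ∨ ∃ u ∈ s, ∃ a : ℝ, 0 < a ∧ ∃ w ∈ PointedCone.hull ℝ s, v = a • u + w := by
  refine PointedCone.hull_induction_real (P := fun v => v = 0 ∨ ∃ u ∈ s, ∃ a : ℝ, 0 < a ∧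
    ∃ w ∈ PointedCone.hull ℝ s, v = a • u + w) (fun v hv => ?_) (Or.inl rfl) ?_ ?_ hv
  · exact Or.inr ⟨v, hv, 1, one_pos, 0, Submodule.zero_mem _, by simp⟩
  · rintro v w hv hw (rfl | ⟨u, hu, a, ha, z, hz, rfl⟩) h
    · simpa using h
    · exact Or.inr ⟨u, hu, a, ha, z + w, Submodule.add_mem _ hz hw, by rw [add_assoc]⟩
  · rintro a ha v (rfl | ⟨u, hu, b, hb, z, hz, rfl⟩)
    · simp
    · exact Or.inr ⟨u, hu, a * b, mul_pos ha hb, a • z, PointedCone.smul_mem_hull ha.le hz,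
        by rw [smul_add, smul_smul]⟩

/-- If a linear functional is nonnegative on the generators of a cone and vanishes among them only
at `u`, then it vanishes on the cone only along the ray of `u`. -/
theorem PointedCone.exists_eq_smul_of_mem_hull {s : Set E} {u : E} (l : E →ₗ[ℝ] ℝ)
    (hl : ∀ v ∈ s, v = u ∨ 0 < l v) (hu : l u = 0) {v : E} (hv : v ∈ PointedCone.hull ℝ s)
    (h0 : l v = 0) : ∃ a : ℝ, 0 ≤ a ∧ v = a • u := by
  have hnonneg : ∀ v ∈ s, 0 ≤ l v := fun v hv => by
    rcases hl v hv with rfl | h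
    exacts [hu.ge, h.le]
  revert h0
  refine PointedCone.hull_induction_real (P := fun v => l v = 0 → ∃ a : ℝ, 0 ≤ a ∧ v = a • u)
    (fun v hv h => ?_) (fun _ => ⟨0, le_rfl, by simp⟩) (fun v w hv hw h h' h0 => ?_)
    (fun a ha v h h0 => ?_) hv
  · rcases hl v hv with rfl | h'
    · exact ⟨1, zero_le_one, by simp⟩
    · exact absurd h h'.ne'
  · have h1 := PointedCone.map_nonneg_of_mem_hull l hnonneg hv
    have h2 := PointedCone.map_nonneg_of_mem_hull l hnonneg hw
    rw [map_add] at h0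
    obtain ⟨a, ha, rfl⟩ := h (by linarith)
    obtain ⟨b, hb, rfl⟩ := h' (by linarith)
    exact ⟨a + b, add_nonneg ha hb, (add_smul _ _ _).symm⟩
  · rw [map_smul, smul_eq_mul] at h0
    obtain ⟨b, hb, rfl⟩ := h ((mul_eq_zero.1 h0).resolve_left ha.ne')
    exact ⟨a * b, by positivity, by rw [smul_smul]⟩

/-- A convex set that contains `x` and `x + u` for all generators `u` of a cone contains an initial
piece of every ray from `x` in a direction of the cone. -/
theorem Convex.exists_add_smul_mem_of_mem_hull {s K : Set E} (hK : Convex ℝ K) {x : E}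
    (hx : x ∈ K) (hs : ∀ u ∈ s, x + u ∈ K) {v : E} (hv : v ∈ PointedCone.hull ℝ s) :
    ∃ ε : ℝ, 0 < ε ∧ ∀ a : ℝ, 0 ≤ a → a ≤ ε → x + a • v ∈ K := by
  have key : ∀ v : E, ∀ ε : ℝ, 0 < ε → x + ε • v ∈ K →
      ∀ a : ℝ, 0 ≤ a → a ≤ ε → x + a • v ∈ K := fun v ε hε h a ha haε => by
    have := hK.add_smul_mem hx h (t := a / ε) ⟨by positivity, (div_le_one hε).2 haε⟩
    rwa [smul_smul, div_mul_cancel₀ _ hε.ne'] at this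
  refine PointedCone.hull_induction_real
    (P := fun v => ∃ ε : ℝ, 0 < ε ∧ ∀ a : ℝ, 0 ≤ a → a ≤ ε → x + a • v ∈ K)
    (fun v hv => ?_) ⟨1, one_pos, by simpa using fun _ _ _ => hx⟩ ?_ ?_ hv
  · exact ⟨1, one_pos, key v 1 one_pos (by simpa using hs v hv)⟩
  · rintro v w - - ⟨ε, hε, h⟩ ⟨ε', hε', h'⟩
    have h0 : 0 < min ε ε' := lt_min hε hε'
    refine ⟨min ε ε' / 2, by positivity, key _ _ (by positivity) ?_⟩
    have := hK (h _ h0.le (min_le_left _ _)) (h' _ h0.le (min_le_right _ _))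
      (a := 1 / 2) (b := 1 / 2) (by norm_num) (by norm_num) (by norm_num)
    convert this using 1
    module
  · rintro a ha v ⟨ε, hε, h⟩
    refine ⟨ε / a, by positivity, key _ _ (by positivity) ?_⟩
    rw [smul_smul, div_mul_cancel₀ _ ha.ne']
    exact h ε hε.le le_rfl

theorem LinearIndependent.exists_linearMap_apply_eq {ι : Type*} {v : ι → E}
    (hv : LinearIndependent ℝ v) (g : ι → ℝ) : ∃ l : E →ₗ[ℝ] ℝ, ∀ i, l (v i) = g i := by
  obtain ⟨l, hl⟩ := LinearMap.exists_extend ((Module.Basis.span hv).constr ℝ g)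
  refine ⟨l, fun i => ?_⟩
  have h1 : l (v i) = (l ∘ₗ (Submodule.span ℝ (Set.range v)).subtype)
      (Module.Basis.span hv i) := by
    simp [Module.Basis.span_apply]
  rw [h1, hl, Module.Basis.constr_basis]

end Cone

/-! ### Cutting a chord of the unit sphere by a smaller concentric sphere -/

section CutRatio

variable {E : Type*} [NormedAddCommGroup E]

/-- The proportion at which an edge from `x` to `y` of the unit ball is first cut by the sphere of
radius `1 - δ`: the smaller root of `t * (1 - t) * ‖y - x‖ ^ 2 = 1 - (1 - δ) ^ 2`. -/
noncomputable def cutRatio (δ : ℝ) (x y : E) : ℝ :=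
  (1 - √(1 - 4 * ((1 - (1 - δ) ^ 2) / ‖y - x‖ ^ 2))) / 2

theorem cutRatio_comm (δ : ℝ) (x y : E) : cutRatio δ x y = cutRatio δ y x := by
  rw [cutRatio, cutRatio, norm_sub_rev]

variable {δ : ℝ} {x y : E}

/-- The depth `δ` is smaller than the depth of the midpoint of the edge from `x` to `y`. -/
def IsEdgeDepth (δ : ℝ) (x y : E) : Prop := 4 * (1 - (1 - δ) ^ 2) < ‖y - x‖ ^ 2

theorem cutRatio_pos (h0 : 0 < δ) (h1 : δ < 1) (hxy : x ≠ y) : 0 < cutRatio δ x y := by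
  have h2 : 0 < ‖y - x‖ ^ 2 := by
    have := norm_pos_iff.2 (sub_ne_zero.2 hxy.symm); positivity
  have h3 : 0 < (1 - (1 - δ) ^ 2) / ‖y - x‖ ^ 2 := div_pos (by nlinarith) h2
  have h4 : √(1 - 4 * ((1 - (1 - δ) ^ 2) / ‖y - x‖ ^ 2)) < 1 := by
    rw [Real.sqrt_lt' one_pos]; linarith
  rw [cutRatio]; linarith

theorem cutRatio_lt_half (hxy : x ≠ y) (h : IsEdgeDepth δ x y) : cutRatio δ x y < 1 / 2 := by
  have h2 : 0 < ‖y - x‖ ^ 2 := by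
    have := norm_pos_iff.2 (sub_ne_zero.2 hxy.symm); positivity
  have h3 : (1 - (1 - δ) ^ 2) / ‖y - x‖ ^ 2 < 1 / 4 := by
    rw [div_lt_iff₀ h2]; unfold IsEdgeDepth at h; linarith
  have h4 : 0 < √(1 - 4 * ((1 - (1 - δ) ^ 2) / ‖y - x‖ ^ 2)) := Real.sqrt_pos.2 (by linarith)
  rw [cutRatio]; linarith

theorem cutRatio_mul (hxy : x ≠ y) (h : 4 * (1 - (1 - δ) ^ 2) ≤ ‖y - x‖ ^ 2) :
    cutRatio δ x y * (1 - cutRatio δ x y) * ‖y - x‖ ^ 2 = 1 - (1 - δ) ^ 2 := by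
  have h2 : 0 < ‖y - x‖ ^ 2 := by
    have := norm_pos_iff.2 (sub_ne_zero.2 hxy.symm); positivity
  have h3 : (1 - (1 - δ) ^ 2) / ‖y - x‖ ^ 2 ≤ 1 / 4 := by
    rw [div_le_iff₀ h2]; linarith
  have h4 : √(1 - 4 * ((1 - (1 - δ) ^ 2) / ‖y - x‖ ^ 2)) ^ 2 =
      1 - 4 * ((1 - (1 - δ) ^ 2) / ‖y - x‖ ^ 2) := Real.sq_sqrt (by linarith)
  have h5 : (1 - (1 - δ) ^ 2) / ‖y - x‖ ^ 2 * ‖y - x‖ ^ 2 = 1 - (1 - δ) ^ 2 :=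
    div_mul_cancel₀ _ h2.ne'
  rw [← h5, cutRatio]
  congr 1
  linear_combination (-1 / 4) * h4

end CutRatio

section Sphere

variable {E : Type*} [NormedAddCommGroup E] [InnerProductSpace ℝ E] {δ : ℝ} {x y : E}

theorem norm_sq_add_smul_sub {x y : E} (hx : ‖x‖ = 1) (hy : ‖y‖ = 1) (t : ℝ) :
    ‖x + t • (y - x)‖ ^ 2 = 1 - t * (1 - t) * ‖y - x‖ ^ 2 := by
  rw [norm_add_sq_real, norm_smul, mul_pow, Real.norm_eq_abs, sq_abs, norm_sub_sq_real,
    inner_smul_right, inner_sub_right, real_inner_self_eq_norm_sq, hx, hy, real_inner_comm]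
  ring

/-- The point nearer to `x` of the two points at which the edge from `x` to `y` is cut by the
sphere of radius `1 - δ`. -/
noncomputable def cutPoint (δ : ℝ) (x y : E) : E := x + cutRatio δ x y • (y - x)

theorem cutPoint_comm (δ : ℝ) (x y : E) :
    cutPoint δ y x = x + (1 - cutRatio δ x y) • (y - x) := by
  rw [cutPoint, cutRatio_comm]; module

theorem norm_add_smul_sub_eq_iff (h1 : δ < 1) (hx : ‖x‖ = 1) (hy : ‖y‖ = 1) (t : ℝ) :
    ‖x + t • (y - x)‖ = 1 - δ ↔ t * (1 - t) * ‖y - x‖ ^ 2 = 1 - (1 - δ) ^ 2 := by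
  rw [← sq_eq_sq₀ (norm_nonneg _) (by linarith), norm_sq_add_smul_sub hx hy]
  constructor <;> intro h <;> linarith

theorem segment_inter_sphere (h0 : 0 < δ) (h1 : δ < 1) (hx : ‖x‖ = 1) (hy : ‖y‖ = 1)
    (hxy : x ≠ y) (h : 4 * (1 - (1 - δ) ^ 2) ≤ ‖y - x‖ ^ 2) :
    segment ℝ x y ∩ Metric.sphere 0 (1 - δ) = {cutPoint δ x y, cutPoint δ y x} := by
  have h2 : 0 < ‖y - x‖ ^ 2 := by
    have := norm_pos_iff.2 (sub_ne_zero.2 hxy.symm); positivity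
  have hm := cutRatio_mul hxy h
  have hpos := cutRatio_pos h0 h1 hxy
  have hle : cutRatio δ x y ≤ 1 / 2 := by
    have := Real.sqrt_nonneg (1 - 4 * ((1 - (1 - δ) ^ 2) / ‖y - x‖ ^ 2))
    rw [cutRatio]; linarith
  ext w
  rw [segment_eq_image', Set.mem_inter_iff, mem_sphere_zero_iff_norm, cutPoint_comm δ x y, cutPoint]
  constructor
  · rintro ⟨⟨t, -, rfl⟩, hw⟩
    have hw := (norm_add_smul_sub_eq_iff h1 hx hy t).1 hw
    have h3 : (t - cutRatio δ x y) * (t - (1 - cutRatio δ x y)) = 0 := by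
      rw [← hm] at hw
      have := mul_right_cancel₀ h2.ne' hw
      linear_combination -this
    rcases mul_eq_zero.1 h3 with h3 | h3
    · left; rw [sub_eq_zero.1 h3]
    · right; rw [sub_eq_zero.1 h3]; exact Set.mem_singleton _
  · rintro (rfl | rfl)
    · exact ⟨⟨_, ⟨hpos.le, by linarith⟩, rfl⟩, (norm_add_smul_sub_eq_iff h1 hx hy _).2 hm⟩
    · refine ⟨⟨_, ⟨by linarith, by linarith⟩, rfl⟩, (norm_add_smul_sub_eq_iff h1 hx hy _).2 ?_⟩
      rw [← hm]; ring

theorem ncard_segment_inter_sphere_eq_two_iff (h0 : 0 < δ) (h1 : δ < 1) (hx : ‖x‖ = 1)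
    (hy : ‖y‖ = 1) (hxy : x ≠ y) :
    (segment ℝ x y ∩ Metric.sphere 0 (1 - δ)).ncard = 2 ↔ IsEdgeDepth δ x y := by
  have h2 : 0 < ‖y - x‖ ^ 2 := by
    have := norm_pos_iff.2 (sub_ne_zero.2 hxy.symm); positivity
  constructor
  · intro hc
    have hle : 4 * (1 - (1 - δ) ^ 2) ≤ ‖y - x‖ ^ 2 := by
      obtain ⟨w, hw, hw'⟩ : (segment ℝ x y ∩ Metric.sphere 0 (1 - δ)).Nonempty := by
        rw [Set.nonempty_iff_ne_empty]; intro h; simp [h] at hc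
      rw [segment_eq_image'] at hw
      obtain ⟨t, -, rfl⟩ := hw
      have := (norm_add_smul_sub_eq_iff h1 hx hy t).1 (mem_sphere_zero_iff_norm.1 hw')
      nlinarith [mul_nonneg (sq_nonneg (2 * t - 1)) h2.le]
    refine lt_of_le_of_ne hle fun he => ?_
    -- If the sphere touches the edge, then both cut points are the midpoint.
    have hr : cutRatio δ x y = 1 / 2 := by
      have : 4 * ((1 - (1 - δ) ^ 2) / ‖y - x‖ ^ 2) = 1 := by
        rw [← mul_div_assoc, he, div_self h2.ne']
      rw [cutRatio, this]; simp
    rw [segment_inter_sphere h0 h1 hx hy hxy hle, cutPoint_comm δ x y, cutPoint, hr] at hc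
    norm_num at hc
  · intro h
    rw [segment_inter_sphere h0 h1 hx hy hxy h.le, Set.ncard_pair]
    rw [cutPoint_comm δ x y, cutPoint]
    intro he
    have h3 := cutRatio_lt_half hxy h
    have := smul_left_injective ℝ (sub_ne_zero.2 hxy.symm) (add_left_cancel he)
    linarith

theorem mem_extremePoints_convexHull_of_norm_eq_one {S : Set E} (hS : ∀ x ∈ S, ‖x‖ = 1) {x : E}
    (hx : x ∈ S) : x ∈ (convexHull ℝ S).extremePoints ℝ := by
  have hsub : convexHull ℝ S ⊆ Metric.closedBall (0 : E) 1 :=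
    convexHull_min (fun y hy => by simp [hS y hy]) (convex_closedBall 0 1)
  refine inter_extremePoints_subset_extremePoints_of_subset hsub ⟨subset_convexHull ℝ S hx, ?_⟩
  exact StrictConvexSpace.sphere_subset_extremePoints_closedBall _ one_ne_zero (by simp [hS x hx])

theorem extremePoints_convexHull_eq_of_norm_eq_one {S : Set E} (hS : ∀ x ∈ S, ‖x‖ = 1) :
    (convexHull ℝ S).extremePoints ℝ = S :=
  Set.Subset.antisymm extremePoints_convexHull_subset
    fun _ hx => mem_extremePoints_convexHull_of_norm_eq_one hS hx

end Sphere

/-! ### Hanoi graphs under truncation -/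

/-- The truncation of a graph: every vertex is replaced by a clique with one vertex for each edge
at it, so that the new vertices are the oriented edges, and every old edge joins its two
orientations. -/
def dartGraph {V : Type*} (G : SimpleGraph V) : SimpleGraph G.Dart where
  Adj d e := d ≠ e ∧ (d.fst = e.fst ∨ e = d.symm)
  symm := ⟨fun d e h => ⟨h.1.symm, h.2.imp Eq.symm fun h' => by rw [h', d.symm_symm]⟩⟩
  loopless := ⟨fun _ h => h.1 rfl⟩

namespace HanoiState

variable {r n : ℕ}

/-- The entry `i` lies in the tail segment on which only the last two values of `z` occur. -/
def InTail (z : Fin (n + 2) → Fin (r + 1)) (i : Fin (n + 2)) : Prop :=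
  ∀ j, i ≤ j → z j = z (Fin.last (n + 1)) ∨ z j = z (Fin.last n).castSucc

open Classical in
/-- The involution on all sequences of length at least two: the last two values are exchanged on
the longest tail segment on which no others occur. -/
noncomputable def flip (z : Fin (n + 2) → Fin (r + 1)) (i : Fin (n + 2)) : Fin (r + 1) :=
  if InTail z i then Equiv.swap (z (Fin.last (n + 1))) (z (Fin.last n).castSucc) (z i) else z i

theorem inTail_last (z : Fin (n + 2) → Fin (r + 1)) : InTail z (Fin.last (n + 1)) :=
  fun j hj => Or.inl (by rw [Fin.last_le_iff.1 hj])

theorem inTail_castSucc_last (z : Fin (n + 2) → Fin (r + 1)) :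
    InTail z (Fin.last n).castSucc := by
  intro j hj
  induction j using Fin.lastCases with
  | last => exact Or.inl rfl
  | cast j =>
    rw [Fin.castSucc_le_castSucc_iff, Fin.last_le_iff] at hj
    exact Or.inr (by rw [hj])

theorem flip_of_inTail {z : Fin (n + 2) → Fin (r + 1)} {i : Fin (n + 2)} (h : InTail z i) :
    flip z i = Equiv.swap (z (Fin.last (n + 1))) (z (Fin.last n).castSucc) (z i) := if_pos h

theorem flip_of_not_inTail {z : Fin (n + 2) → Fin (r + 1)} {i : Fin (n + 2)} (h : ¬InTail z i) :
    flip z i = z i := if_neg h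

theorem flip_last (z : Fin (n + 2) → Fin (r + 1)) :
    flip z (Fin.last (n + 1)) = z (Fin.last n).castSucc := by
  rw [flip_of_inTail (inTail_last z), Equiv.swap_apply_left]

theorem flip_castSucc_last (z : Fin (n + 2) → Fin (r + 1)) :
    flip z (Fin.last n).castSucc = z (Fin.last (n + 1)) := by
  rw [flip_of_inTail (inTail_castSucc_last z), Equiv.swap_apply_right]

/-- The involution permutes the occurrences of the last two values among themselves. -/
theorem flip_eq_or_iff (z : Fin (n + 2) → Fin (r + 1)) (i : Fin (n + 2)) :
    (flip z i = z (Fin.last (n + 1)) ∨ flip z i = z (Fin.last n).castSucc) ↔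
      (z i = z (Fin.last (n + 1)) ∨ z i = z (Fin.last n).castSucc) := by
  by_cases h : InTail z i
  · rw [flip_of_inTail h, Equiv.swap_apply_eq_iff, Equiv.swap_apply_eq_iff,
      Equiv.swap_apply_left, Equiv.swap_apply_right, or_comm]
  · rw [flip_of_not_inTail h]

theorem inTail_flip_iff (z : Fin (n + 2) → Fin (r + 1)) (i : Fin (n + 2)) :
    InTail (flip z) i ↔ InTail z i := by
  unfold InTail
  rw [flip_last, flip_castSucc_last]
  refine forall₂_congr fun j _ => ?_
  rw [or_comm, flip_eq_or_iff]

theorem flip_flip (z : Fin (n + 2) → Fin (r + 1)) : flip (flip z) = z := by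
  funext i
  by_cases h : InTail z i
  · rw [flip_of_inTail ((inTail_flip_iff z i).2 h), flip_last, flip_castSucc_last,
      flip_of_inTail h, Equiv.swap_comm, Equiv.swap_apply_self]
  · rw [flip_of_not_inTail (mt (inTail_flip_iff z i).1 h), flip_of_not_inTail h]

theorem isHanoiState_flip {z : Fin (n + 2) → Fin (r + 1)} (hz : IsHanoiState z) :
    IsHanoiState (flip z) := by
  intro i j hij
  have hle : i ≤ j := Fin.le_def.2 (by omega)
  by_cases hj : InTail z j
  · by_cases hi : InTail z i
    · rw [flip_of_inTail hi, flip_of_inTail hj]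
      exact fun h => hz i j hij (Equiv.injective _ h)
    · -- At the start of the tail, `z i` is neither of the two values and `flip z j` is one.
      have hzi : ¬(z i = z (Fin.last (n + 1)) ∨ z i = z (Fin.last n).castSucc) := by
        refine fun h => hi fun m hm => ?_
        rcases hm.eq_or_lt with rfl | hm
        · exact h
        · exact hj m (Fin.le_def.2 (by have := Fin.lt_def.1 hm; omega))
      intro h
      rw [flip_of_not_inTail hi] at h
      rw [h, flip_eq_or_iff] at hzi
      exact hzi (hj j le_rfl)
  · have hi : ¬InTail z i := fun h => hj fun m hm => h m (hle.trans hm)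
    rw [flip_of_not_inTail hi, flip_of_not_inTail hj]
    exact hz i j hij

/-- The involution as a map of the Hanoi states of length at least two. -/
noncomputable def involution (z : HanoiState r (n + 2)) : HanoiState r (n + 2) :=
  ⟨flip z.1, isHanoiState_flip z.2⟩

theorem involution_involution (z : HanoiState r (n + 2)) : involution (involution z) = z :=
  Subtype.ext (flip_flip z.1)

theorem isInvolution_iff {x y : HanoiState r (n + 2)} : IsInvolution x y ↔ y = involution x := by
  constructor
  · rintro ⟨a, b, ha, hb, h⟩
    obtain rfl : a = Fin.last (n + 1) := Fin.ext (by simp; omega)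
    obtain rfl : b = (Fin.last n).castSucc := Fin.ext (by simp; omega)
    refine Subtype.ext (funext fun i => (h i).trans ?_)
    by_cases hi : InTail x.1 i
    · exact (if_pos hi).trans (flip_of_inTail hi).symm
    · exact (if_neg hi).trans (flip_of_not_inTail hi).symm
  · rintro rfl
    refine ⟨Fin.last (n + 1), (Fin.last n).castSucc, rfl, rfl, fun i => ?_⟩
    by_cases hi : InTail x.1 i
    · exact (flip_of_inTail hi).trans (if_pos hi).symm
    · exact (flip_of_not_inTail hi).trans (if_neg hi).symm

/-- The sequence without its last entry. -/
def init (z : HanoiState r (n + 1)) : HanoiState r n :=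
  ⟨fun i => z.1 i.castSucc, fun _ _ hij => z.2 _ _ hij⟩

theorem init_apply (z : HanoiState r (n + 1)) (i : Fin n) : (init z).1 i = z.1 i.castSucc := rfl

theorem isAdjustment_iff {x y : HanoiState r (n + 1)} :
    IsAdjustment x y ↔ init x = init y := by
  constructor
  · intro h
    exact Subtype.ext (funext fun i => (h i.castSucc (by simp)).symm)
  · intro h i hi
    have := congrFun (congrArg Subtype.val h) ⟨i, by omega⟩
    exact this.symm

theorem hanoiGraph_adj_iff {x y : HanoiState r (n + 2)} :
    (hanoiGraph r (n + 2)).Adj x y ↔ x ≠ y ∧ (init x = init y ∨ y = involution x) := by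
  rw [hanoiGraph, SimpleGraph.fromRel_adj]
  simp only [isAdjustment_iff, isInvolution_iff]
  refine and_congr_right fun _ => ⟨?_, Or.inl⟩
  rintro (h | h | rfl)
  · exact h
  · exact Or.inl h.symm
  · exact Or.inr (involution_involution y).symm

theorem hanoiGraph_one_adj_iff {x y : HanoiState r 1} :
    (hanoiGraph r 1).Adj x y ↔ x.1 0 ≠ y.1 0 := by
  rw [hanoiGraph, SimpleGraph.fromRel_adj]
  have hinit : init x = init y := Subtype.ext (funext fun i => i.elim0)
  simp only [isAdjustment_iff, hinit, true_or, and_true, ne_eq, not_iff_not, Subtype.ext_iff]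
  exact ⟨fun h => by rw [h], fun h => funext fun i => by rwa [Subsingleton.elim i 0]⟩

/-- Extending `x` by a value `c` that makes it a Hanoi state. -/
def snoc (x : HanoiState r (n + 1)) (c : Fin (r + 1)) (hc : x.1 (Fin.last n) ≠ c) :
    HanoiState r (n + 2) :=
  ⟨Fin.snoc (α := fun _ => Fin (r + 1)) x.1 c, fun i j hij => by
    induction i using Fin.lastCases with
    | last => have := j.2; simp at hij; omega
    | cast i =>
      rw [Fin.snoc_castSucc]
      induction j using Fin.lastCases with
      | last =>
        obtain rfl : i = Fin.last n := Fin.ext (by simpa using hij)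
        rwa [Fin.snoc_last]
      | cast j => rw [Fin.snoc_castSucc]; exact x.2 i j (by simpa using hij)⟩

theorem init_snoc (x : HanoiState r (n + 1)) (c : Fin (r + 1)) (hc : x.1 (Fin.last n) ≠ c) :
    init (snoc x c hc) = x :=
  Subtype.ext (funext fun _ => Fin.snoc_castSucc (α := fun _ => Fin (r + 1)) ..)

theorem snoc_last (x : HanoiState r (n + 1)) (c : Fin (r + 1)) (hc : x.1 (Fin.last n) ≠ c) :
    (snoc x c hc).1 (Fin.last (n + 1)) = c :=
  Fin.snoc_last (α := fun _ => Fin (r + 1)) ..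

theorem ext_init {z w : HanoiState r (n + 1)} (h : init z = init w)
    (hl : z.1 (Fin.last n) = w.1 (Fin.last n)) : z = w := by
  refine Subtype.ext (funext fun i => ?_)
  induction i using Fin.lastCases with
  | last => exact hl
  | cast i => exact congrFun (congrArg Subtype.val h) i

/-- The last entry of the initial part of `involution z` is the last entry of `z`. -/
theorem init_involution_last (z : HanoiState r (n + 2)) :
    (init (involution z)).1 (Fin.last n) = z.1 (Fin.last (n + 1)) :=
  flip_castSucc_last z.1

/-- The last two entries of a state are distinct. -/
theorem castSucc_last_ne_last (z : HanoiState r (n + 2)) :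
    z.1 (Fin.last n).castSucc ≠ z.1 (Fin.last (n + 1)) :=
  z.2 _ _ rfl

/-- If the last value of `z` differs from the last but two, then the involution exchanges the last
two entries only, which is an adjustment of the initial part. -/
theorem flip_castSucc_castSucc_of_ne {z : HanoiState r (n + 3)}
    (h : z.1 (Fin.last (n + 2)) ≠ z.1 (Fin.last n).castSucc.castSucc) (i : Fin (n + 1)) :
    flip z.1 i.castSucc.castSucc = z.1 i.castSucc.castSucc := by
  refine flip_of_not_inTail fun hi => ?_
  rcases hi (Fin.last n).castSucc.castSucc (Fin.le_def.2 (by simp; omega)) with h' | h'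
  · exact h h'.symm
  · exact z.2 (Fin.last n).castSucc.castSucc (Fin.last (n + 1)).castSucc rfl h'

/-- If the last value of `z` is also the last but two, then the involution of `z` restricts to the
involution of the initial part. -/
theorem init_involution_of_eq {z : HanoiState r (n + 3)}
    (h : z.1 (Fin.last (n + 2)) = z.1 (Fin.last n).castSucc.castSucc) :
    init (involution z) = involution (init z) := by
  have key : ∀ i : Fin (n + 2), InTail z.1 i.castSucc ↔ InTail (init z).1 i := by
    intro i
    constructor
    · intro hi j hj
      have := hi j.castSucc (Fin.castSucc_le_castSucc_iff.2 hj)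
      rw [h] at this
      exact this.symm
    · intro hi j hj
      induction j using Fin.lastCases with
      | last => exact Or.inl rfl
      | cast j =>
        have := hi j (Fin.castSucc_le_castSucc_iff.1 hj)
        rw [h]
        exact this.symm
  refine Subtype.ext (funext fun i => ?_)
  change flip z.1 i.castSucc = flip (init z).1 i
  by_cases hi : InTail z.1 i.castSucc
  · rw [flip_of_inTail hi, flip_of_inTail ((key i).1 hi), h, Equiv.swap_comm]; rfl
  · rw [flip_of_not_inTail hi, flip_of_not_inTail (mt (key i).2 hi)]; rfl

theorem init_adj_init_involution (z : HanoiState r (n + 2)) :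
    (hanoiGraph r (n + 1)).Adj (init z) (init (involution z)) := by
  have hlast : (init z).1 (Fin.last n) ≠ (init (involution z)).1 (Fin.last n) := by
    rw [init_involution_last]; exact castSucc_last_ne_last z
  cases n with
  | zero => exact hanoiGraph_one_adj_iff.2 hlast
  | succ n =>
    refine hanoiGraph_adj_iff.2 ⟨fun h => hlast (by rw [← h]), ?_⟩
    by_cases h : z.1 (Fin.last (n + 2)) = z.1 (Fin.last n).castSucc.castSucc
    · exact Or.inr (init_involution_of_eq h)
    · exact Or.inl (Subtype.ext (funext fun i => (flip_castSucc_castSucc_of_ne h i).symm))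

theorem last_ne_last_of_adj {x y : HanoiState r (n + 1)} (h : (hanoiGraph r (n + 1)).Adj x y) :
    x.1 (Fin.last n) ≠ y.1 (Fin.last n) := by
  cases n with
  | zero => exact hanoiGraph_one_adj_iff.1 h
  | succ n =>
    obtain ⟨hne, h | rfl⟩ := hanoiGraph_adj_iff.1 h
    · exact fun hl => hne (ext_init h hl)
    · exact fun hl => castSucc_last_ne_last x (hl.trans (flip_last x.1)).symm

/-- Every edge from `x` to `y` comes from the state that extends `x` by the last entry of `y`. -/
theorem init_involution_snoc {x y : HanoiState r (n + 1)}
    (h : (hanoiGraph r (n + 1)).Adj x y) :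
    init (involution (snoc x _ (last_ne_last_of_adj h))) = y := by
  have hl : (init (involution (snoc x _ (last_ne_last_of_adj h)))).1 (Fin.last n) =
      y.1 (Fin.last n) := by rw [init_involution_last, snoc_last]
  cases n with
  | zero => exact ext_init (Subtype.ext (funext fun i => i.elim0)) hl
  | succ n =>
    set z := snoc x _ (last_ne_last_of_adj h) with hz
    have hzx : init z = x := init_snoc ..
    have hz2 : z.1 (Fin.last n).castSucc.castSucc = x.1 (Fin.last n).castSucc := by
      rw [← hzx]; rfl
    have hz0 : z.1 (Fin.last (n + 2)) = y.1 (Fin.last (n + 1)) := snoc_last ..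
    obtain ⟨hne, h' | rfl⟩ := hanoiGraph_adj_iff.1 h
    · refine ext_init (Eq.trans (Subtype.ext (funext fun i => ?_)) h') hl
      refine (flip_castSucc_castSucc_of_ne ?_ i).trans (by rw [← hzx]; rfl)
      rw [hz2, hz0]
      have := congrFun (congrArg Subtype.val h') (Fin.last n)
      rw [init_apply, init_apply] at this
      rw [this]
      exact (castSucc_last_ne_last y).symm
    · rw [init_involution_of_eq, hzx]
      rw [hz2, hz0]
      exact flip_last x.1

/-- A Hanoi state `z` of length `n + 2` as the oriented edge from its initial part to the initial
part of its involution. -/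
noncomputable def toDart (z : HanoiState r (n + 2)) : (hanoiGraph r (n + 1)).Dart :=
  ⟨(init z, init (involution z)), init_adj_init_involution z⟩

theorem toDart_bijective : Function.Bijective (toDart (r := r) (n := n)) := by
  constructor
  · intro z w h
    have h1 : init z = init w := congrArg (·.fst) h
    have h2 : init (involution z) = init (involution w) := congrArg (·.snd) h
    refine ext_init h1 ?_
    rw [← init_involution_last, h2, init_involution_last]
  · rintro ⟨⟨x, y⟩, h⟩
    refine ⟨snoc x _ (last_ne_last_of_adj h), SimpleGraph.Dart.ext _ _ (Prod.ext ?_ ?_)⟩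
    · exact init_snoc ..
    · exact init_involution_snoc h

theorem toDart_involution (z : HanoiState r (n + 2)) :
    toDart (involution z) = (toDart z).symm := by
  refine SimpleGraph.Dart.ext _ _ (Prod.ext rfl ?_)
  change init (involution (involution z)) = init z
  rw [involution_involution]

/-- Truncating a Hanoi graph gives the next one. -/
noncomputable def dartIso (r n : ℕ) :
    hanoiGraph r (n + 2) ≃g dartGraph (hanoiGraph r (n + 1)) where
  toEquiv := Equiv.ofBijective toDart toDart_bijective
  map_rel_iff' := by
    intro z w
    rw [hanoiGraph_adj_iff]
    change toDart z ≠ toDart w ∧ (init z = init w ∨ toDart w = (toDart z).symm) ↔ _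
    rw [toDart_bijective.1.ne_iff, ← toDart_involution, toDart_bijective.1.eq_iff]

end HanoiState

/-! ### Simple polytopes inscribed in the unit sphere -/

section SimplePolytope

variable {V W E : Type*} [NormedAddCommGroup E] [InnerProductSpace ℝ E]

/-- The points `p x` of the unit sphere are the vertices of a simple polytope with graph `G`: at
each vertex, the directions of the edges given by `G` are linearly independent (expressed by the
existence of linear functionals with prescribed values on them), and the cone that they generate
contains the whole polytope. -/
structure IsSimplePolytope (G : SimpleGraph V) (p : V → E) : Prop where
  norm_eq_one : ∀ x, ‖p x‖ = 1
  injective : Function.Injective p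
  exists_linearMap : ∀ x (g : V → ℝ), ∃ l : E →ₗ[ℝ] ℝ, ∀ y, G.Adj x y → l (p y - p x) = g y
  sub_mem_hull : ∀ x s, p s - p x ∈ PointedCone.hull ℝ ((fun y => p y - p x) '' G.neighborSet x)

namespace IsSimplePolytope

variable {G : SimpleGraph V} {H : SimpleGraph W} {p : V → E}

theorem comp_iso (h : IsSimplePolytope G p) (e : H ≃g G) : IsSimplePolytope H (p ∘ e) where
  norm_eq_one x := h.norm_eq_one (e x)
  injective := h.injective.comp e.injective
  exists_linearMap x g := by
    obtain ⟨l, hl⟩ := h.exists_linearMap (e x) (g ∘ e.symm)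
    exact ⟨l, fun y hy => by simpa using hl (e y) (e.map_adj_iff.2 hy)⟩
  sub_mem_hull x s := by
    refine Submodule.span_mono ?_ (h.sub_mem_hull (e x) (e s))
    rintro _ ⟨y, hy, rfl⟩
    refine ⟨e.symm y, ?_, by simp⟩
    rw [SimpleGraph.mem_neighborSet] at hy ⊢
    rwa [← e.map_adj_iff, RelIso.apply_symm_apply]

/-- A linear functional that exceeds its value at a vertex `x` by at least `c > 0` at all neighbours
of `x` does so at all other vertices. Otherwise consider a vertex `m ≠ x` where it is minimal:
this is not a neighbour of `x`, so that the functional does not decrease along any edge from `m`,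
hence not from `m` to `x`. -/
theorem le_apply_sub [Finite V] (h : IsSimplePolytope G p) {x : V} {l : E →ₗ[ℝ] ℝ} {c : ℝ}
    (hc : 0 < c) (hl : ∀ y, G.Adj x y → c ≤ l (p y - p x)) {s : V} (hs : s ≠ x) :
    c ≤ l (p s - p x) := by
  obtain ⟨m, hm, hmin⟩ := Set.exists_min_image {s | s ≠ x} (fun s => l (p s - p x))
    (Set.toFinite _) ⟨s, hs⟩
  refine le_trans ?_ (hmin s hs)
  by_contra! hlt
  have h1 : 0 ≤ l (p x - p m) := by
    refine PointedCone.map_nonneg_of_mem_hull l ?_ (h.sub_mem_hull m x)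
    rintro _ ⟨w, hw, rfl⟩
    have hwx : w ≠ x := by
      rintro rfl
      exact absurd (hl m (SimpleGraph.Adj.symm hw)) (not_le.2 hlt)
    have := hmin w hwx
    simp only [map_sub] at this ⊢
    linarith
  have hnonneg : ∀ v ∈ (fun y => p y - p x) '' G.neighborSet x, 0 ≤ l v := by
    rintro _ ⟨y, hy, rfl⟩
    exact hc.le.trans (hl y hy)
  rcases PointedCone.exists_eq_smul_add_of_mem_hull (h.sub_mem_hull x m) with
    h0 | ⟨_, ⟨y, hy, rfl⟩, a, ha, w, hw, heq⟩
  · exact hm (h.injective (sub_eq_zero.1 h0))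
  · have h2 := PointedCone.map_nonneg_of_mem_hull l hnonneg hw
    have h3 : 0 < a * l (p y - p x) := mul_pos ha (hc.trans_le (hl y hy))
    have h4 : l (p m - p x) = a * l (p y - p x) + l w := by
      rw [heq, map_add, map_smul, smul_eq_mul]
    rw [map_sub] at h1 h4
    linarith

theorem sub_mem_hull_of_mem_convexHull (h : IsSimplePolytope G p) (x : V) {w : E}
    (hw : w ∈ convexHull ℝ (Set.range p)) :
    w - p x ∈ PointedCone.hull ℝ ((fun y => p y - p x) '' G.neighborSet x) := by
  have hconv : Convex ℝ {w | w - p x ∈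
      PointedCone.hull ℝ ((fun y => p y - p x) '' G.neighborSet x)} := by
    intro u hu v hv a b ha hb hab
    have := Submodule.add_mem _ (PointedCone.smul_mem_hull ha hu)
      (PointedCone.smul_mem_hull hb hv)
    have he : a • u + b • v - p x = a • (u - p x) + b • (v - p x) := by
      rw [← eq_sub_iff_add_eq'] at hab
      rw [hab]; module
    rw [Set.mem_ofPred_eq, he]
    exact this
  refine convexHull_min ?_ hconv hw
  rintro _ ⟨s, rfl⟩
  exact h.sub_mem_hull x s

theorem norm_le_one_of_mem_convexHull (h : IsSimplePolytope G p) {w : E}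
    (hw : w ∈ convexHull ℝ (Set.range p)) : ‖w‖ ≤ 1 := by
  have hsub : convexHull ℝ (Set.range p) ⊆ Metric.closedBall (0 : E) 1 :=
    convexHull_min (by rintro _ ⟨y, rfl⟩; simp [h.norm_eq_one y]) (convex_closedBall 0 1)
  simpa using hsub hw

/-- For an edge from `x` to `y` of `G`, the segment is the face on which a functional is minimal
that vanishes in the direction of this edge and is positive in the other edge directions
at `x`. -/
theorem isExtreme_segment_of_adj (h : IsSimplePolytope G p) {x y : V} (hxy : G.Adj x y) :
    IsExtreme ℝ (convexHull ℝ (Set.range p)) (segment ℝ (p x) (p y)) := by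
  classical
  obtain ⟨l, hl⟩ := h.exists_linearMap x (fun z => if z = y then 0 else 1)
  have hly : l (p y - p x) = 0 := by simpa using hl y hxy
  have hgen : ∀ v ∈ (fun z => p z - p x) '' G.neighborSet x, v = p y - p x ∨ 0 < l v := by
    rintro _ ⟨z, hz, rfl⟩
    by_cases hzy : z = y
    · exact Or.inl (by rw [hzy])
    · right
      change 0 < l (p z - p x)
      rw [hl z hz, if_neg hzy]; exact one_pos
  have hnonneg : ∀ w ∈ convexHull ℝ (Set.range p), 0 ≤ l (w - p x) := fun w hw =>
    PointedCone.map_nonneg_of_mem_hull l (fun v hv => by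
      rcases hgen v hv with rfl | h'
      exacts [hly.ge, h'.le]) (h.sub_mem_hull_of_mem_convexHull x hw)
  refine ⟨segment_subset_convexHull ⟨x, rfl⟩ ⟨y, rfl⟩, ?_⟩
  rintro u hu v hv z hz ⟨a, b, ha, hb, hab, rfl⟩
  rw [segment_eq_image'] at hz
  obtain ⟨t, -, ht⟩ := hz
  have ht : p x + t • (p y - p x) = a • u + b • v := ht
  have hzero : a * l (u - p x) + b * l (v - p x) = 0 := by
    have h1 : a • (u - p x) + b • (v - p x) = t • (p y - p x) := by
      rw [← eq_sub_iff_add_eq'] at hab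
      rw [← add_right_inj (p x), ht, hab]; module
    have h2 := congrArg l h1
    simpa only [map_add, map_smul, smul_eq_mul, hly, mul_zero] using h2
  have hu0 : l (u - p x) = 0 := by
    have h1 := mul_nonneg ha.le (hnonneg u hu)
    have h2 := mul_nonneg hb.le (hnonneg v hv)
    exact (mul_eq_zero.1 (by linarith : a * l (u - p x) = 0)).resolve_left ha.ne'
  obtain ⟨c, hc, hcu⟩ := PointedCone.exists_eq_smul_of_mem_hull l hgen hly
    (h.sub_mem_hull_of_mem_convexHull x hu) hu0
  have hueq : u = p x + c • (p y - p x) := by rw [← hcu]; abel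
  rw [segment_eq_image']
  refine ⟨c, ⟨hc, ?_⟩, hueq.symm⟩
  -- Beyond `p y` the ray from `p x` through `p y` leaves the unit ball.
  have hn := norm_sq_add_smul_sub (h.norm_eq_one x) (h.norm_eq_one y) c
  rw [← hueq] at hn
  have h1 : ‖u‖ ^ 2 ≤ 1 := by
    have := h.norm_le_one_of_mem_convexHull hu
    have := norm_nonneg u
    nlinarith
  have h2 : 0 < ‖p y - p x‖ ^ 2 := by
    have := norm_pos_iff.2 (sub_ne_zero.2 (h.injective.ne hxy.ne'))
    positivity
  by_contra! hc1
  nlinarith [mul_pos (mul_pos (zero_lt_one.trans hc1) (sub_pos.2 hc1)) h2]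

/-- If `s` is another vertex, then the direction from `x` to `s` has an edge direction at `x`, from
`x` to `y` say, as a summand. If the segment is a face, then it contains points other than
`p x` of that edge, so that `s = y`. -/
theorem adj_of_isExtreme_segment (h : IsSimplePolytope G p) {x s : V} (hxs : x ≠ s)
    (hface : IsExtreme ℝ (convexHull ℝ (Set.range p)) (segment ℝ (p x) (p s))) : G.Adj x s := by
  rcases PointedCone.exists_eq_smul_add_of_mem_hull (h.sub_mem_hull x s) with
    h0 | ⟨_, ⟨y, hy, rfl⟩, a, ha, w, hw, heq⟩
  · exact absurd (h.injective (sub_eq_zero.1 h0)).symm hxs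
  have hK := convex_convexHull ℝ (Set.range p)
  have hxK : p x ∈ convexHull ℝ (Set.range p) := subset_convexHull ℝ _ ⟨x, rfl⟩
  have hgen : ∀ u ∈ (fun z => p z - p x) '' G.neighborSet x,
      p x + u ∈ convexHull ℝ (Set.range p) := by
    rintro _ ⟨z, -, rfl⟩
    rw [add_sub_cancel]
    exact subset_convexHull ℝ _ ⟨z, rfl⟩
  obtain ⟨ε, hε, hεK⟩ := hK.exists_add_smul_mem_of_mem_hull hxK hgen
    (PointedCone.smul_mem_hull ha.le (Submodule.subset_span ⟨y, hy, rfl⟩))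
  obtain ⟨ε', hε', hεK'⟩ := hK.exists_add_smul_mem_of_mem_hull hxK hgen hw
  set η := min (min ε ε') 1 with hη
  have hη0 : 0 < η := lt_min (lt_min hε hε') one_pos
  have hmem : p x + (η / 2) • (p s - p x) ∈ segment ℝ (p x) (p s) := by
    rw [segment_eq_image']
    exact ⟨η / 2, ⟨by positivity, by linarith [min_le_right (min ε ε') 1]⟩, rfl⟩
  have hedge := hface.left_mem_of_mem_openSegment
    (hεK η hη0.le ((min_le_left _ _).trans (min_le_left _ _)))
    (hεK' η hη0.le ((min_le_left _ _).trans (min_le_right _ _))) hmem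
    ⟨1 / 2, 1 / 2, by norm_num, by norm_num, by norm_num, by rw [heq]; module⟩
  rw [segment_eq_image'] at hedge
  obtain ⟨t, -, ht⟩ := hedge
  have ht : t • (p s - p x) = (η * a) • (p y - p x) := by
    rw [mul_smul]; exact add_left_cancel ht
  have hpos : 0 < η * a := mul_pos hη0 ha
  have hyx : p y - p x ≠ 0 := sub_ne_zero.2 (h.injective.ne (G.ne_of_adj hy).symm)
  -- A line meets the unit sphere in at most two points, so that `p y` and `p s` coincide.
  have hyeq : p y = p x + ((η * a)⁻¹ * t) • (p s - p x) := by
    rw [mul_smul, ht, inv_smul_smul₀ hpos.ne']; abel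
  have hn := norm_sq_add_smul_sub (h.norm_eq_one x) (h.norm_eq_one s) ((η * a)⁻¹ * t)
  rw [← hyeq, h.norm_eq_one] at hn
  have hsx : ‖p s - p x‖ ^ 2 ≠ 0 := by
    have := sub_ne_zero.2 (h.injective.ne hxs.symm)
    positivity
  have hc0 : (η * a)⁻¹ * t ≠ 0 := by
    intro h0
    rw [h0, zero_smul, add_zero] at hyeq
    exact hyx (sub_eq_zero.2 hyeq)
  have hc1 : (η * a)⁻¹ * t = 1 := by
    have h1 : ((η * a)⁻¹ * t) * ((1 - (η * a)⁻¹ * t) * ‖p s - p x‖ ^ 2) = 0 := by linarith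
    have h2 := (mul_eq_zero.1 ((mul_eq_zero.1 h1).resolve_left hc0)).resolve_right hsx
    linarith
  rw [hc1, one_smul, add_sub_cancel] at hyeq
  rw [← h.injective hyeq]
  exact hy

theorem isExtreme_segment_iff (h : IsSimplePolytope G p) {x y : V} (hxy : x ≠ y) :
    IsExtreme ℝ (convexHull ℝ (Set.range p)) (segment ℝ (p x) (p y)) ↔ G.Adj x y :=
  ⟨h.adj_of_isExtreme_segment hxy, h.isExtreme_segment_of_adj⟩

theorem extremePoints_eq (h : IsSimplePolytope G p) :
    (convexHull ℝ (Set.range p)).extremePoints ℝ = Set.range p :=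
  extremePoints_convexHull_eq_of_norm_eq_one (by rintro _ ⟨x, rfl⟩; exact h.norm_eq_one x)

/-- The 1-skeleton of a simple polytope is its graph. -/
noncomputable def skeletonIso (h : IsSimplePolytope G p) :
    G ≃g hullSkeleton (Set.range p) where
  toEquiv := (Equiv.ofInjective p h.injective).trans (Equiv.setCongr h.extremePoints_eq.symm)
  map_rel_iff' := by
    intro x y
    change (_ ≠ _ ∧ IsExtreme ℝ _ (segment ℝ (p x) (p y))) ↔ _
    rw [(Equiv.injective _).ne_iff]
    constructor
    · exact fun ⟨hne, hf⟩ => (h.isExtreme_segment_iff hne).1 hf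
    · exact fun ha => ⟨ha.ne, (h.isExtreme_segment_iff ha.ne).2 ha⟩

theorem coe_skeletonIso (h : IsSimplePolytope G p) (x : V) : (h.skeletonIso x : E) = p x := rfl

theorem isTruncationDepth_iff (h : IsSimplePolytope G p) {δ : ℝ} :
    IsTruncationDepth (Set.range p) δ ↔
      0 < δ ∧ δ < 1 ∧ ∀ x y, G.Adj x y → IsEdgeDepth δ (p x) (p y) := by
  refine and_congr_right fun h0 => and_congr_right fun h1 => ?_
  rw [h.skeletonIso.toEquiv.surjective.forall₂]
  refine forall₂_congr fun x y => ?_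
  refine imp_congr_ctx h.skeletonIso.map_adj_iff fun hxy => ?_
  exact ncard_segment_inter_sphere_eq_two_iff h0 h1 (h.norm_eq_one x) (h.norm_eq_one y)
    (h.injective.ne hxy.ne)

/-- All sufficiently small depths are admissible, as the finitely many edges have midpoints in the
open unit ball. -/
theorem exists_isTruncationDepth [Finite V] (h : IsSimplePolytope G p) :
    ∃ δ₀ : ℝ, 0 < δ₀ ∧ ∀ δ : ℝ, 0 < δ → δ < δ₀ → IsTruncationDepth (Set.range p) δ := by
  have hd : ∀ d : G.Dart, 0 < ‖p d.snd - p d.fst‖ ^ 2 := fun d => by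
    have := norm_pos_iff.2 (sub_ne_zero.2 (h.injective.ne d.snd_ne_fst))
    positivity
  have : Finite G.Dart := Finite.of_injective _ SimpleGraph.Dart.toProd_injective
  obtain ⟨c, hc, hcle⟩ : ∃ c : ℝ, 0 < c ∧ ∀ d : G.Dart, c ≤ ‖p d.snd - p d.fst‖ ^ 2 := by
    rcases isEmpty_or_nonempty G.Dart with he | he
    · exact ⟨1, one_pos, fun d => he.elim d⟩
    · obtain ⟨d, hmin⟩ := Finite.exists_min fun d : G.Dart => ‖p d.snd - p d.fst‖ ^ 2
      exact ⟨_, hd d, hmin⟩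
  refine ⟨min 1 (c / 8), by positivity, fun δ h0 hlt => h.isTruncationDepth_iff.2
    ⟨h0, hlt.trans_le (min_le_left _ _), fun x y hxy => ?_⟩⟩
  have h1 := hlt.trans_le (min_le_right _ _)
  have h2 := hcle ⟨(x, y), hxy⟩
  change c ≤ ‖p y - p x‖ ^ 2 at h2
  unfold IsEdgeDepth
  nlinarith [sq_nonneg δ]

/-- The point of the truncation that lies on the edge `d.fst`, `d.snd`, near `d.fst`. -/
noncomputable def truncationPoint (δ : ℝ) (p : V → E) (d : G.Dart) : E :=
  (1 - δ)⁻¹ • cutPoint δ (p d.fst) (p d.snd)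

theorem truncation_eq_range (h : IsSimplePolytope G p) {δ : ℝ}
    (hδ : IsTruncationDepth (Set.range p) δ) :
    truncation (Set.range p) δ = Set.range (truncationPoint (G := G) δ p) := by
  obtain ⟨h0, h1, hδ⟩ := h.isTruncationDepth_iff.1 hδ
  have hseg : ∀ x y, G.Adj x y → segment ℝ (p x) (p y) ∩ Metric.sphere 0 (1 - δ) =
      {cutPoint δ (p x) (p y), cutPoint δ (p y) (p x)} := fun x y hxy =>
    segment_inter_sphere h0 h1 (h.norm_eq_one x) (h.norm_eq_one y) (h.injective.ne hxy.ne)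
      (hδ x y hxy).le
  ext z
  constructor
  · rintro ⟨x, y, hxy, w, hw, rfl⟩
    obtain ⟨x, rfl⟩ := h.skeletonIso.surjective x
    obtain ⟨y, rfl⟩ := h.skeletonIso.surjective y
    have hxy := h.skeletonIso.map_adj_iff.1 hxy
    rw [coe_skeletonIso, coe_skeletonIso, hseg x y hxy] at hw
    rcases hw with rfl | rfl
    · exact ⟨⟨(x, y), hxy⟩, rfl⟩
    · exact ⟨⟨(y, x), hxy.symm⟩, rfl⟩
  · rintro ⟨d, rfl⟩
    refine ⟨h.skeletonIso d.fst, h.skeletonIso d.snd, h.skeletonIso.map_adj_iff.2 d.adj,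
      cutPoint δ (p d.fst) (p d.snd), ?_, rfl⟩
    rw [coe_skeletonIso, coe_skeletonIso, hseg _ _ d.adj]
    exact Set.mem_insert _ _

/-- The hyperplane through the cut points next to a vertex `x` separates `x` strictly from all other
cut points. It is given by the functional `l` with value `1 / t` on the edge direction from `x`
to `y` if the cut point is at the proportion `t < 1 / 2` of that edge. -/
theorem exists_cutting_functional [Finite V] (h : IsSimplePolytope G p) {δ : ℝ} (h0 : 0 < δ)
    (h1 : δ < 1) (hδ : ∀ x y, G.Adj x y → IsEdgeDepth δ (p x) (p y)) (x : V) :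
    ∃ l : E →ₗ[ℝ] ℝ, (∀ y, G.Adj x y → l (p y - p x) = (cutRatio δ (p x) (p y))⁻¹) ∧
      ∀ d : G.Dart, d.fst ≠ x → 1 < l (cutPoint δ (p d.fst) (p d.snd) - p x) := by
  obtain ⟨l, hl⟩ := h.exists_linearMap x (fun y => (cutRatio δ (p x) (p y))⁻¹)
  refine ⟨l, hl, fun d hd => ?_⟩
  have hpos := cutRatio_pos h0 h1 (h.injective.ne d.adj.ne)
  have hlt := cutRatio_lt_half (h.injective.ne d.adj.ne) (hδ _ _ d.adj)
  have h2 : ∀ s, s ≠ x → 2 ≤ l (p s - p x) := fun s hs =>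
    h.le_apply_sub two_pos (fun y hy => by
      rw [hl y hy, le_inv_comm₀ two_pos (cutRatio_pos h0 h1 (h.injective.ne hy.ne)), ← one_div]
      exact (cutRatio_lt_half (h.injective.ne hy.ne) (hδ x y hy)).le) hs
  have hexp : l (cutPoint δ (p d.fst) (p d.snd) - p x) =
      (1 - cutRatio δ (p d.fst) (p d.snd)) * l (p d.fst - p x) +
        cutRatio δ (p d.fst) (p d.snd) * l (p d.snd - p x) := by
    rw [cutPoint, ← smul_eq_mul, ← smul_eq_mul, ← map_smul, ← map_smul, ← map_add]
    congr 1; module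
  have h3 := h2 _ hd
  have h4 : 0 ≤ l (p d.snd - p x) := by
    by_cases hx : d.snd = x
    · rw [hx, sub_self, map_zero]
    · linarith [h2 _ hx]
  rw [hexp]
  nlinarith

/-! ### Truncation of simple polytopes -/

theorem norm_cutPoint (h : IsSimplePolytope G p) {δ : ℝ} (h1 : δ < 1) {x y : V}
    (hxy : G.Adj x y) (hδ : IsEdgeDepth δ (p x) (p y)) : ‖cutPoint δ (p x) (p y)‖ = 1 - δ :=
  (norm_add_smul_sub_eq_iff h1 (h.norm_eq_one x) (h.norm_eq_one y) _).2
    (cutRatio_mul (h.injective.ne hxy.ne) hδ.le)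

theorem truncationPoint_injective [Finite V] (h : IsSimplePolytope G p) {δ : ℝ}
    (hδ : IsTruncationDepth (Set.range p) δ) :
    Function.Injective (truncationPoint (G := G) δ p) := by
  classical
  obtain ⟨h0, h1, hδ⟩ := h.isTruncationDepth_iff.1 hδ
  intro d e hde
  have hde : cutPoint δ (p d.fst) (p d.snd) = cutPoint δ (p e.fst) (p e.snd) :=
    smul_right_injective E (inv_ne_zero (sub_pos.2 h1).ne') hde
  have hpos : ∀ x y, G.Adj x y → 0 < cutRatio δ (p x) (p y) := fun x y hxy =>
    cutRatio_pos h0 h1 (h.injective.ne hxy.ne)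
  have hfst : e.fst = d.fst := by
    by_contra hne
    obtain ⟨l, hl, hl'⟩ := h.exists_cutting_functional h0 h1 hδ d.fst
    have h2 := hl' e hne
    rw [← hde, cutPoint, add_sub_cancel_left, map_smul, smul_eq_mul, hl _ d.adj,
      mul_inv_cancel₀ (hpos _ _ d.adj).ne'] at h2
    exact lt_irrefl _ h2
  obtain ⟨⟨x, y⟩, hxy⟩ := d
  obtain ⟨⟨x', z⟩, hxz⟩ := e
  obtain rfl : x' = x := hfst
  obtain ⟨l, hl⟩ := h.exists_linearMap x' (fun w => if w = y then 1 else 0)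
  have h2 := congrArg l (add_left_cancel hde)
  simp only [map_smul, smul_eq_mul] at h2
  rw [hl y hxy, hl z hxz, if_pos rfl, mul_one] at h2
  by_cases hzy : z = y
  · subst hzy; rfl
  · rw [if_neg hzy, mul_zero] at h2
    exact absurd h2 (hpos _ _ hxy).ne'

theorem truncationPoint_sub_of_fst_eq (δ : ℝ) (p : V → E) {x y z : V} (hxy : G.Adj x y)
    (hxz : G.Adj x z) :
    truncationPoint δ p (⟨(x, z), hxz⟩ : G.Dart) -
      truncationPoint δ p (⟨(x, y), hxy⟩ : G.Dart) =
      (1 - δ)⁻¹ • (cutRatio δ (p x) (p z) • (p z - p x) -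
        cutRatio δ (p x) (p y) • (p y - p x)) := by
  simp only [truncationPoint, cutPoint]; module

theorem truncationPoint_symm_sub (δ : ℝ) (p : V → E) {x y : V} (hxy : G.Adj x y) :
    truncationPoint δ p (⟨(y, x), hxy.symm⟩ : G.Dart) -
      truncationPoint δ p (⟨(x, y), hxy⟩ : G.Dart) =
      ((1 - δ)⁻¹ * (1 - 2 * cutRatio δ (p x) (p y))) • (p y - p x) := by
  simp only [truncationPoint, cutPoint, cutRatio_comm δ (p y) (p x)]; module

/-- Truncation turns a simple polytope into a simple polytope whose graph is the truncated graph.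
At the cut point on the edge from `x` to `y`, the new edge directions are that of the old edge and
the differences to the other cut points next to `x`; together with the cutting functional of `x`
they show that the new cone consists of the vectors of the old one beyond the cut. -/
theorem truncation [Finite V] (h : IsSimplePolytope G p) {δ : ℝ}
    (hδ : IsTruncationDepth (Set.range p) δ) :
    IsSimplePolytope (dartGraph G) (truncationPoint (G := G) δ p) := by
  classical
  have hinj := h.truncationPoint_injective hδ
  obtain ⟨h0, h1, hδ⟩ := h.isTruncationDepth_iff.1 hδ
  have hρ : 0 < (1 - δ)⁻¹ := inv_pos.2 (sub_pos.2 h1)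
  have hpos : ∀ x y, G.Adj x y → 0 < cutRatio δ (p x) (p y) := fun x y hxy =>
    cutRatio_pos h0 h1 (h.injective.ne hxy.ne)
  have hlt : ∀ x y, G.Adj x y → 0 < 1 - 2 * cutRatio δ (p x) (p y) := fun x y hxy => by
    linarith [cutRatio_lt_half (h.injective.ne hxy.ne) (hδ x y hxy)]
  refine ⟨fun d => ?_, hinj, fun d g => ?_, fun d e => ?_⟩
  · rw [truncationPoint, norm_smul, h.norm_cutPoint h1 d.adj (hδ _ _ d.adj),
      Real.norm_of_nonneg hρ.le, inv_mul_cancel₀ (sub_pos.2 h1).ne']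
  · obtain ⟨⟨x, y⟩, hxy⟩ := d
    -- The value on the old edge direction is forced by `g` at the reversed edge, and then the
    -- values on the other old edge directions are forced by `g` at the other edges from `x`.
    set a : ℝ := g ⟨(y, x), hxy.symm⟩ / ((1 - δ)⁻¹ * (1 - 2 * cutRatio δ (p x) (p y))) with ha
    obtain ⟨l, hl⟩ := h.exists_linearMap x (fun z => if z = y then a else
      if hz : G.Adj x z then (g ⟨(x, z), hz⟩ / (1 - δ)⁻¹ + cutRatio δ (p x) (p y) * a) /
        cutRatio δ (p x) (p z) else 0)
    have hly : l (p y - p x) = a := by rw [hl y hxy, if_pos rfl]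
    refine ⟨l, ?_⟩
    rintro e ⟨hne, he | rfl⟩
    · obtain ⟨⟨x', z⟩, hxz⟩ := e
      obtain rfl : x = x' := he
      have hzy : z ≠ y := by rintro rfl; exact hne rfl
      rw [truncationPoint_sub_of_fst_eq, map_smul, map_sub, map_smul, map_smul, hly, hl z hxz,
        if_neg hzy, dif_pos hxz]
      simp only [smul_eq_mul]
      rw [mul_div_cancel₀ _ (hpos x z hxz).ne', add_sub_cancel_right, mul_div_cancel₀ _ hρ.ne']
    · change l (truncationPoint δ p (⟨(y, x), hxy.symm⟩ : G.Dart) - _) = g ⟨(y, x), hxy.symm⟩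
      rw [truncationPoint_symm_sub, map_smul, hly, smul_eq_mul, ha,
        mul_div_cancel₀ _ (mul_pos hρ (hlt x y hxy)).ne']
  · obtain ⟨⟨x, y⟩, hxy⟩ := d
    set C := PointedCone.hull ℝ ((fun e => truncationPoint δ p e -
      truncationPoint δ p (⟨(x, y), hxy⟩ : G.Dart)) ''
        (dartGraph G).neighborSet ⟨(x, y), hxy⟩) with hC
    have hy : p y - p x ∈ C := by
      have hmem : truncationPoint δ p (⟨(y, x), hxy.symm⟩ : G.Dart) -
          truncationPoint δ p (⟨(x, y), hxy⟩ : G.Dart) ∈ C := by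
        refine Submodule.subset_span ⟨_, ⟨fun heq => hxy.ne ?_, Or.inr rfl⟩, rfl⟩
        exact congrArg (·.fst) heq
      rw [truncationPoint_symm_sub] at hmem
      have hc := mul_pos hρ (hlt x y hxy)
      have := PointedCone.smul_mem_hull (inv_nonneg.2 hc.le) hmem
      rwa [inv_smul_smul₀ hc.ne'] at this
    have hz : ∀ z, G.Adj x z → cutRatio δ (p x) (p z) • (p z - p x) -
        cutRatio δ (p x) (p y) • (p y - p x) ∈ C := by
      intro z hxz
      by_cases hzy : z = y
      · rw [hzy, sub_self]; exact Submodule.zero_mem _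
      have hmem : truncationPoint δ p (⟨(x, z), hxz⟩ : G.Dart) -
          truncationPoint δ p (⟨(x, y), hxy⟩ : G.Dart) ∈ C := by
        refine Submodule.subset_span
          ⟨(⟨(x, z), hxz⟩ : G.Dart), ⟨fun heq => hzy ?_, Or.inl rfl⟩, rfl⟩
        exact (congrArg (·.snd) heq).symm
      rw [truncationPoint_sub_of_fst_eq] at hmem
      have := PointedCone.smul_mem_hull (inv_nonneg.2 hρ.le) hmem
      rwa [inv_smul_smul₀ hρ.ne'] at this
    obtain ⟨l, hl, hl'⟩ := h.exists_cutting_functional h0 h1 hδ x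
    -- Projecting the old cone along the old edge to the kernel of the cutting functional.
    have hproj : ∀ v ∈ PointedCone.hull ℝ ((fun y => p y - p x) '' G.neighborSet x),
        v - (l v * cutRatio δ (p x) (p y)) • (p y - p x) ∈ C := by
      intro v hv
      refine PointedCone.hull_induction_real
        (P := fun v => v - (l v * cutRatio δ (p x) (p y)) • (p y - p x) ∈ C) ?_ ?_ ?_ ?_ hv
      · rintro _ ⟨z, hxz, rfl⟩
        have := PointedCone.smul_mem_hull (inv_nonneg.2 (hpos x z hxz).le) (hz z hxz)
        rw [smul_sub, inv_smul_smul₀ (hpos x z hxz).ne', smul_smul] at this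
        change p z - p x - (l (p z - p x) * _) • _ ∈ C
        rwa [hl z hxz]
      · simp
      · intro v w _ _ hv hw
        have := Submodule.add_mem _ hv hw
        rw [map_add]
        convert this using 1
        module
      · intro b hb v hv
        have := PointedCone.smul_mem_hull hb.le hv
        rw [map_smul, smul_eq_mul]
        convert this using 1
        module
    set q := cutPoint δ (p e.fst) (p e.snd) with hq
    have hlq : 1 ≤ l (q - p x) := by
      by_cases hex : e.fst = x
      · have hadj : G.Adj x e.snd := hex ▸ e.adj
        rw [hq, hex, cutPoint, add_sub_cancel_left, map_smul, smul_eq_mul, hl _ hadj,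
          mul_inv_cancel₀ (hpos _ _ hadj).ne']
      · exact (hl' e hex).le
    have hqx : q - p x ∈ PointedCone.hull ℝ ((fun y => p y - p x) '' G.neighborSet x) := by
      refine h.sub_mem_hull_of_mem_convexHull x ?_
      refine segment_subset_convexHull (Set.mem_range_self e.fst) (Set.mem_range_self e.snd) ?_
      rw [segment_eq_image']
      exact ⟨_, ⟨(hpos _ _ e.adj).le, by linarith [hlt _ _ e.adj, hpos _ _ e.adj]⟩, rfl⟩
    have hsum := PointedCone.smul_mem_hull hρ.le (Submodule.add_mem _ (hproj _ hqx)
      (PointedCone.smul_mem_hull (mul_nonneg (sub_nonneg.2 hlq) (hpos x y hxy).le) hy))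
    convert hsum using 1
    change (1 - δ)⁻¹ • q - (1 - δ)⁻¹ • (p x + cutRatio δ (p x) (p y) • (p y - p x)) = _
    clear_value q
    module

end IsSimplePolytope

/-! ### Iterated truncations of a simplex -/

/-- An affinely independent family on the unit sphere spans a simplex, in which any two vertices
are joined by an edge. -/
theorem AffineIndependent.isSimplePolytope_top {p : V → E} (hp : AffineIndependent ℝ p)
    (hnorm : ∀ x, ‖p x‖ = 1) : IsSimplePolytope (⊤ : SimpleGraph V) p where
  norm_eq_one := hnorm
  injective := hp.injective
  exists_linearMap x g := by
    obtain ⟨l, hl⟩ := ((affineIndependent_iff_linearIndependent_vsub ℝ p x).1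
      hp).exists_linearMap_apply_eq (fun y => g y)
    exact ⟨l, fun y hy => hl ⟨y, hy.ne'⟩⟩
  sub_mem_hull x s := by
    by_cases hs : s = x
    · rw [hs, sub_self]; exact Submodule.zero_mem _
    · exact Submodule.subset_span ⟨s, Ne.symm hs, rfl⟩

/-- The Hanoi graph of sequences of length one is complete. -/
def hanoiGraphOneIso (r : ℕ) : hanoiGraph r 1 ≃g (⊤ : SimpleGraph (Fin (r + 1))) where
  toFun x := x.1 0
  invFun i := ⟨fun _ => i, fun a b hab => by omega⟩
  left_inv x := Subtype.ext (funext fun i => by rw [Subsingleton.elim i 0])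
  right_inv _ := rfl
  map_rel_iff' := HanoiState.hanoiGraph_one_adj_iff.symm

/-- The iterated truncations of a simplex are simple polytopes with the Hanoi graphs as graphs. -/
theorem exists_isSimplePolytope_iteratedTruncation {r : ℕ} {p : Fin (r + 1) → E}
    (hp : ∀ i, ‖p i‖ = 1) (hgen : AffineIndependent ℝ p) (δ : ℕ → ℝ) (n : ℕ)
    (hδ : ∀ i, i < n → IsTruncationDepth (iteratedTruncation (Set.range p) δ i) (δ i)) :
    ∃ q : HanoiState r (n + 1) → E, IsSimplePolytope (hanoiGraph r (n + 1)) q ∧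
      iteratedTruncation (Set.range p) δ n = Set.range q := by
  induction n with
  | zero =>
    exact ⟨_, (hgen.isSimplePolytope_top hp).comp_iso (hanoiGraphOneIso r),
      ((hanoiGraphOneIso r).surjective.range_comp p).symm⟩
  | succ n ih =>
    obtain ⟨q, hq, hrange⟩ := ih fun i hi => hδ i (by omega)
    have hδn := hδ n n.lt_succ_self
    rw [hrange] at hδn
    refine ⟨_, (hq.truncation hδn).comp_iso (HanoiState.dartIso r n), ?_⟩
    rw [(HanoiState.dartIso r n).surjective.range_comp, ← hq.truncation_eq_range hδn, ← hrange]
    rfl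

end SimplePolytope

theorem mainTheorem4 {E : Type*} [NormedAddCommGroup E] [InnerProductSpace ℝ E]
    (r k : ℕ) (hk : 1 ≤ k)
    (p : Fin (r + 1) → E) (hp : ∀ i, p i ∈ Metric.sphere (0 : E) 1)
    (hgen : AffineIndependent ℝ p)
    (δ : ℕ → ℝ)
    (hδ : ∀ i, i < k - 1 →
      IsTruncationDepth (iteratedTruncation (Set.range p) δ i) (δ i)) :
    Nonempty (hullSkeleton (iteratedTruncation (Set.range p) δ (k - 1)) ≃g hanoiGraph r k) ∧
    ∃ δ₀ : ℝ, 0 < δ₀ ∧ ∀ δ' : ℝ, 0 < δ' → δ' < δ₀ →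
      IsTruncationDepth (iteratedTruncation (Set.range p) δ (k - 1)) δ' := by
  obtain ⟨n, rfl⟩ : ∃ n, k = n + 1 := ⟨k - 1, by omega⟩
  rw [Nat.add_sub_cancel] at hδ ⊢
  obtain ⟨q, hq, hrange⟩ := exists_isSimplePolytope_iteratedTruncation
    (fun i => mem_sphere_zero_iff_norm.1 (hp i)) hgen δ n hδ
  rw [hrange]
  exact ⟨⟨hq.skeletonIso.symm⟩, hq.exists_isTruncationDepth⟩
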